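/- Let $d \ge 2$, let $y_1 < \cdots < y_d$ be real numbers, let $c_1,\dots,c_d \in \mathbb C\setminus\{0\}$, and let $p(x) = \sum_{j=1}^d c_j e^{2\pi i y_j x}$, $x \in \mathbb R$, with entire extension $P(z) = \sum_{j=1}^d c_j e^{2\pi i y_j z}$, $z \in \mathbb C$. Let $Z_r(p) \subset \mathbb R$ be the set of zeros of $p$ and $Z_c(p) \subset \mathbb C$ the set of zeros of $P$. For $R > 0$ let $N_r(R)$ be the number of zeros of $p$ in $\{x \in \mathbb R : |x| < R\}$ and $N_c(R)$ the number of zeros of $P$ in $\{z \in \mathbb C : |z| < R\}$, both counted with multiplicity. The density of the real zeros is $\rho_r(p) = \lim_{R\to\infty} N_r(R)/(2R)$ and the density of the complex zeros is $\rho_c(p) = \lim_{R\to\infty} N_c(R)/(2R)$. Then: 1. $\rho_c(p)$ exists and $\rho_c(p) = y_d - y_1$. 2. $Z_r(p) = Z_c(p)$ (that is, $P$ has only real zeros) if and only if $\rho_r(p)$ exists and $\rho_r(p) = \rho_c(p)$. 3. The same holds with the upper density: $Z_r(p) = Z_c(p)$ if and only if $\limsup_{R\to\infty} N_r(R)/(2R)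 = \rho_c(p)$. -/

import Mathlib

open Filter Topology

noncomputable section

/-- The character `χ_y(x) = exp(2πi y x)` of the real line. -/
def chi (y x : ℝ) : ℂ := Complex.exp (2 * Real.pi * Complex.I * y * x)

/-- The trigonometric polynomial `p = ∑ j, c j • χ_{y j}`, a function on the real line. -/
def trigPoly {d : ℕ} (c : Fin d → ℂ) (y : Fin d → ℝ) (x : ℝ) : ℂ :=
  ∑ j, c j * chi (y j) x

/-- The entire extension `P` of the trigonometric polynomial `p`. -/
def entireExt {d : ℕ} (c : Fin d → ℂ) (y : Fin d → ℝ) (z : ℂ) : ℂ :=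
  ∑ j, c j * Complex.exp (2 * Real.pi * Complex.I * y j * z)

theorem entireExt_ofReal {d : ℕ} (c : Fin d → ℂ) (y : Fin d → ℝ) (x : ℝ) :
    entireExt c y x = trigPoly c y x := rfl

theorem differentiable_entireExt {d : ℕ} (c : Fin d → ℂ) (y : Fin d → ℝ) :
    Differentiable ℂ (entireExt c y) := by
  unfold entireExt
  fun_prop

/-- The set of real roots of `p`. -/
def realZeros {d : ℕ} (c : Fin d → ℂ) (y : Fin d → ℝ) : Set ℝ :=
  {x | trigPoly c y x = 0}

/-- The set of complex roots of the entire extension `P` of `p`. -/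
def complexZeros {d : ℕ} (c : Fin d → ℂ) (y : Fin d → ℝ) : Set ℂ :=
  {z | entireExt c y z = 0}

/-- The number of real roots of `p` in the open ball (interval) of radius `R` around `0`,
counted with multiplicity. -/
def realCount {d : ℕ} (c : Fin d → ℂ) (y : Fin d → ℝ) (R : ℝ) : ℕ :=
  ∑ᶠ x ∈ realZeros c y ∩ Metric.ball 0 R, analyticOrderNatAt (trigPoly c y) x

/-- The number of complex roots of `P` in the open ball (disc) of radius `R` around `0`,
counted with multiplicity. -/
def complexCount {d : ℕ} (c : Fin d → ℂ) (y : Fin d → ℝ) (R : ℝ) : ℕ :=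
  ∑ᶠ z ∈ complexZeros c y ∩ Metric.ball 0 R, analyticOrderNatAt (entireExt c y) z

/-- A multiset with counting function `N` has density `ρ`: the number of its points in the ball
of radius `R`, divided by the length `2 * R` of a real interval of radius `R`, tends to `ρ`. -/
def HasDensity (N : ℝ → ℕ) (ρ : ℝ) : Prop :=
  Tendsto (fun R : ℝ => (N R : ℝ) / (2 * R)) atTop (𝓝 ρ)

/-- The upper density of a multiset with counting function `N`. -/
def upperDensity (N : ℝ → ℕ) : ℝ :=
  limsup (fun R : ℝ => (N R : ℝ) / (2 * R)) atTop

end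

/-! Jensen's formula turns the count of complex zeros into a circle average of `log ‖P‖`. Off a
horizontal strip one extreme term dominates, so `log ‖P‖` differs from `growth` by a bounded amount.
On well-chosen circles this persists inside the strip: almost periodicity carries a zero-free pair
of vertical segments out to a relatively dense set of radii (`exists_radius_le_norm_entireExt`). The
average of `growth` over a circle is `2 * (y_d - y_1) * R`, so the logarithmic count equals this up
to a bounded error, on those circles and then, by monotonicity, at all large radii. Comparing nearby
radii recovers the density (`hasDensity_zeroCount_of_zeroLogCount`).

For the equivalences, real and complex orders agree at real zeros, so the two counts coincide when
all zeros are real. A single nonreal zero, on the other hand, reappears near every real point, by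
almost periodicity and a quantitative open mapping theorem (`exists_nonreal_zero_near`). Nonreal
zeros then take up a positive proportion, and even the upper density of the real zeros is strictly
below `y_d - y_1`. -/

/-- The zeros of `f` in the open disc of radius `R` around the origin. -/
noncomputable def zerosInBall (f : ℂ → ℂ) (R : ℝ) : Set ℂ := {z | f z = 0} ∩ Metric.ball 0 R

/-- The number of zeros of `f` in the open disc of radius `R`, with multiplicity. -/
noncomputable def zeroCount (f : ℂ → ℂ) (R : ℝ) : ℕ := ∑ᶠ z ∈ zerosInBall f R, analyticOrderNatAt f z

/-- The logarithmically weighted number of zeros of `f` in the open disc of radius `R`. -/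
noncomputable def zeroLogCount (f : ℂ → ℂ) (R : ℝ) : ℝ :=
  ∑ᶠ z ∈ zerosInBall f R, (analyticOrderNatAt f z : ℝ) * (Real.log R - Real.log ‖z‖)

/-! ### Zero counts of entire functions and Jensen's formula -/

section Entire

variable {f : ℂ → ℂ}

theorem analyticOrderAt_ne_top_of_entire (hf : Differentiable ℂ f) (hf0 : f ≠ 0) (z : ℂ) :
    analyticOrderAt f z ≠ ⊤ := by
  have ha : AnalyticOnNhd ℂ f Set.univ := fun w _ => hf.analyticAt w
  intro h
  rw [analyticOrderAt_eq_top] at h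
  exact hf0 (funext fun w => ha.eqOn_zero_of_preconnected_of_eventuallyEq_zero
    isPreconnected_univ (Set.mem_univ z) h (Set.mem_univ w))

theorem divisor_eq_analyticOrderNatAt (hf : Differentiable ℂ f) {U : Set ℂ} {z : ℂ} (hz : z ∈ U) :
    MeromorphicOn.divisor f U z = (analyticOrderNatAt f z : ℤ) := by
  have hm : MeromorphicOn f U := fun w _ => (hf.analyticAt w).meromorphicAt
  rw [MeromorphicOn.divisor_apply hm hz, (hf.analyticAt z).meromorphicOrderAt_eq]
  unfold analyticOrderNatAt
  cases analyticOrderAt f z <;> simp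

theorem analyticOrderNatAt_pos_of_zero (hf : Differentiable ℂ f) (hf0 : f ≠ 0) {z : ℂ}
    (hz : f z = 0) : 0 < analyticOrderNatAt f z := by
  have h1 : analyticOrderAt f z ≠ 0 := (hf.analyticAt z).analyticOrderAt_ne_zero.2 hz
  rw [← Nat.cast_analyticOrderNatAt (analyticOrderAt_ne_top_of_entire hf hf0 z)] at h1
  exact Nat.pos_of_ne_zero fun h => h1 (by simp [h])

theorem zerosInClosedBall_finite (hf : Differentiable ℂ f) (hf0 : f ≠ 0) (R : ℝ) :
    ({z | f z = 0} ∩ Metric.closedBall 0 R).Finite := by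
  refine ((MeromorphicOn.divisor f (Metric.closedBall 0 R)).finiteSupport
    (isCompact_closedBall 0 R)).subset ?_
  intro z hz
  rw [Function.mem_support, divisor_eq_analyticOrderNatAt hf hz.2]
  exact_mod_cast (analyticOrderNatAt_pos_of_zero hf hf0 hz.1).ne'

theorem zerosInBall_finite (hf : Differentiable ℂ f) (hf0 : f ≠ 0) (R : ℝ) :
    (zerosInBall f R).Finite :=
  (zerosInClosedBall_finite hf hf0 R).subset
    (Set.inter_subset_inter_right _ Metric.ball_subset_closedBall)

theorem zeroSet_countable (hf : Differentiable ℂ f) (hf0 : f ≠ 0) : {z | f z = 0}.Countable := by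
  have : {z | f z = 0} = ⋃ n : ℕ, zerosInBall f n := by
    ext z
    obtain ⟨n, hn⟩ := exists_nat_gt ‖z‖
    simp only [Set.mem_iUnion]
    exact ⟨fun h => ⟨n, h, by simpa using hn⟩, fun ⟨_, h⟩ => h.1⟩
  rw [this]
  exact Set.countable_iUnion fun n => (zerosInBall_finite hf hf0 n).countable

/-- **Jensen's formula** for entire functions, in terms of `zeroLogCount`. -/
theorem circleAverage_log_norm_eq_zeroLogCount (hf : Differentiable ℂ f) {R : ℝ}
    (hR : 0 < R) :
    Real.circleAverage (fun z => Real.log ‖f z‖) 0 R =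
      zeroLogCount f R + Real.log ‖meromorphicTrailingCoeffAt f 0‖ := by
  have hm : MeromorphicOn f (Metric.closedBall 0 |R|) :=
    fun w _ => (hf.analyticAt w).meromorphicAt
  -- Since `Real.log 0 = 0`, a zero at the origin has weight `log R` in `zeroLogCount`; this absorbs
  -- the separate origin term of Jensen's formula.
  rw [MeromorphicOn.circleAverage_log_norm hR.ne' hm, ← countingFunction_finsum_eq_finsum_add hR.ne'
    ((MeromorphicOn.divisor f (Metric.closedBall 0 |R|)).finiteSupport (isCompact_closedBall 0 |R|))]
  congr 1
  unfold zeroLogCount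
  rw [finsum_mem_def]
  refine finsum_congr fun z => ?_
  rw [abs_of_pos hR]
  by_cases hz : z ∈ zerosInBall f R
  · rw [Set.indicator_of_mem hz,
      divisor_eq_analyticOrderNatAt hf (Metric.ball_subset_closedBall hz.2)]
    simp
  · rw [Set.indicator_of_notMem hz]
    by_cases hzR : z ∈ Metric.closedBall (0 : ℂ) R
    · rw [divisor_eq_analyticOrderNatAt hf hzR]
      by_cases hfz : f z = 0
      · have hn : ‖z‖ = R := by
          refine le_antisymm (by simpa using hzR) ?_
          by_contra h
          exact hz ⟨hfz, by simpa using h⟩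
        simp [hn]
      · have : analyticOrderAt f z = 0 := (hf.analyticAt z).analyticOrderAt_eq_zero.2 hfz
        simp [analyticOrderNatAt, this]
    · rw [Function.locallyFinsuppWithin.apply_eq_zero_of_notMem _ hzR]
      simp

theorem zeroCount_eq_sum (hf : Differentiable ℂ f) (hf0 : f ≠ 0) (R : ℝ) :
    zeroCount f R = ∑ z ∈ (zerosInBall_finite hf hf0 R).toFinset, analyticOrderNatAt f z :=
  finsum_mem_eq_finite_toFinset_sum _ _

theorem zeroLogCount_eq_sum (hf : Differentiable ℂ f) (hf0 : f ≠ 0) (R : ℝ) :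
    zeroLogCount f R = ∑ z ∈ (zerosInBall_finite hf hf0 R).toFinset,
      (analyticOrderNatAt f z : ℝ) * (Real.log R - Real.log ‖z‖) :=
  finsum_mem_eq_finite_toFinset_sum _ _

theorem zerosInBall_toFinset_subset (hf : Differentiable ℂ f) (hf0 : f ≠ 0) {R R' : ℝ}
    (h : R ≤ R') : (zerosInBall_finite hf hf0 R).toFinset ⊆
      (zerosInBall_finite hf hf0 R').toFinset := by
  simp only [Set.Finite.toFinset_subset_toFinset]
  exact Set.inter_subset_inter_right _ (Metric.ball_subset_ball h)

/-- Passing from `R` to `R'` raises the weight of each zero already counted by `log R' - log R`, and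
the new zeros have nonnegative weight. This is the lower bound in `N(R') - N(R) = ∫ n(t) dt/t` with
`n` monotone; the next lemma is the upper bound. -/
theorem zeroCount_mul_le_zeroLogCount_sub (hf : Differentiable ℂ f) (hf0 : f ≠ 0) {R R' : ℝ}
    (hR : 0 < R) (h : R ≤ R') :
    zeroCount f R * (Real.log R' - Real.log R) ≤ zeroLogCount f R' - zeroLogCount f R := by
  rw [zeroCount_eq_sum hf hf0, zeroLogCount_eq_sum hf hf0, zeroLogCount_eq_sum hf hf0]
  have key : ∑ z ∈ (zerosInBall_finite hf hf0 R).toFinset,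
      (analyticOrderNatAt f z : ℝ) * (Real.log R' - Real.log ‖z‖) ≤
      ∑ z ∈ (zerosInBall_finite hf hf0 R').toFinset,
      (analyticOrderNatAt f z : ℝ) * (Real.log R' - Real.log ‖z‖) := by
    refine Finset.sum_le_sum_of_subset_of_nonneg (zerosInBall_toFinset_subset hf hf0 h) ?_
    intro z hz hz'
    rw [Set.Finite.mem_toFinset] at hz hz'
    have h1 : R ≤ ‖z‖ := by
      by_contra hlt
      exact hz' ⟨hz.1, by simpa using hlt⟩
    have h2 : ‖z‖ < R' := by simpa using hz.2
    exact mul_nonneg (Nat.cast_nonneg _)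
      (sub_nonneg.2 (Real.log_le_log (hR.trans_le h1) h2.le))
  refine le_trans (le_of_eq ?_) (sub_le_sub_right key _)
  rw [← Finset.sum_sub_distrib]
  push_cast
  rw [Finset.sum_mul]
  exact Finset.sum_congr rfl fun z _ => by ring

theorem zeroLogCount_sub_le_zeroCount_mul (hf : Differentiable ℂ f) (hf0 : f ≠ 0) {R R' : ℝ}
    (hR : 0 < R) (h : R ≤ R') :
    zeroLogCount f R' - zeroLogCount f R ≤ zeroCount f R' * (Real.log R' - Real.log R) := by
  rw [zeroCount_eq_sum hf hf0, zeroLogCount_eq_sum hf hf0, zeroLogCount_eq_sum hf hf0]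
  have key : ∑ z ∈ (zerosInBall_finite hf hf0 R').toFinset,
      (analyticOrderNatAt f z : ℝ) * (Real.log R - Real.log ‖z‖) ≤
      ∑ z ∈ (zerosInBall_finite hf hf0 R).toFinset,
      (analyticOrderNatAt f z : ℝ) * (Real.log R - Real.log ‖z‖) := by
    rw [← Finset.sum_sdiff (zerosInBall_toFinset_subset hf hf0 h)]
    refine add_le_of_nonpos_left (Finset.sum_nonpos ?_)
    intro z hz
    rw [Finset.mem_sdiff, Set.Finite.mem_toFinset, Set.Finite.mem_toFinset] at hz
    have h1 : R ≤ ‖z‖ := by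
      by_contra hlt
      exact hz.2 ⟨hz.1.1, by simpa using hlt⟩
    exact mul_nonpos_of_nonneg_of_nonpos (Nat.cast_nonneg _)
      (sub_nonpos.2 (Real.log_le_log hR h1))
  refine le_trans (sub_le_sub_left key _) (le_of_eq ?_)
  rw [← Finset.sum_sub_distrib]
  push_cast
  rw [Finset.sum_mul]
  exact Finset.sum_congr rfl fun z _ => by ring

theorem zeroLogCount_mono (hf : Differentiable ℂ f) (hf0 : f ≠ 0) {R R' : ℝ}
    (hR : 0 < R) (h : R ≤ R') : zeroLogCount f R ≤ zeroLogCount f R' := by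
  have h1 := zeroCount_mul_le_zeroLogCount_sub hf hf0 hR h
  have h2 := mul_nonneg (Nat.cast_nonneg (α := ℝ) (zeroCount f R))
    (sub_nonneg.2 (Real.log_le_log hR h))
  linarith

/-- If the logarithmic count grows linearly, then the zeros have a density. -/
theorem hasDensity_zeroCount_of_zeroLogCount (hf : Differentiable ℂ f) (hf0 : f ≠ 0) {a C R₀ : ℝ}
    (ha : 0 ≤ a) (hC : ∀ R, R₀ ≤ R → |zeroLogCount f R - 2 * a * R| ≤ C) :
    HasDensity (zeroCount f) a := by
  have hC0 : 0 ≤ C := (abs_nonneg _).trans (hC R₀ le_rfl)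
  -- The count at `R` is squeezed between difference quotients of the logarithmic count over `[R(1 -
  -- ε), R]` and `[R, R(1 + ε)]`. The bounded error costs `O(C / (ε R))`, which vanishes for fixed
  -- `ε` as `R` grows.
  have main : ∀ ε : ℝ, 0 < ε → ε < 1 → ∀ R : ℝ, 0 < R → R₀ ≤ R * (1 - ε) →
      a * (1 - ε) - C / (ε * R) ≤ zeroCount f R / (2 * R) ∧
      zeroCount f R / (2 * R) ≤ a * (1 + ε) + 2 * C / (ε * R) := by
    intro ε h0 h1 R hR hR₀
    have hR₁ : R₀ ≤ R := hR₀.trans (by nlinarith)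
    have hR₂ : R₀ ≤ R * (1 + ε) := hR₁.trans (by nlinarith)
    have b0 := abs_le.1 (hC _ hR₀)
    have b1 := abs_le.1 (hC _ hR₁)
    have b2 := abs_le.1 (hC _ hR₂)
    have u1 := zeroCount_mul_le_zeroLogCount_sub hf hf0 hR
      (show R ≤ R * (1 + ε) by nlinarith)
    have u2 := zeroLogCount_sub_le_zeroCount_mul hf hf0
      (show 0 < R * (1 - ε) from mul_pos hR (by linarith)) (show R * (1 - ε) ≤ R by nlinarith)
    rw [Real.log_mul hR.ne' (by linarith)] at u1 u2
    have l1 : ε / (1 + ε) ≤ Real.log (1 + ε) := by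
      have := Real.one_sub_inv_le_log_of_pos (show 0 < 1 + ε by linarith)
      refine le_trans (le_of_eq ?_) this
      field_simp
      ring
    have l2 : - Real.log (1 - ε) ≤ ε / (1 - ε) := by
      have := Real.one_sub_inv_le_log_of_pos (show 0 < 1 - ε by linarith)
      have h3 : ε / (1 - ε) = -(1 - (1 - ε)⁻¹) := by
        have : 1 - ε ≠ 0 := by linarith
        field_simp
        ring
      linarith
    set n : ℝ := (zeroCount f R : ℝ)
    have hn : 0 ≤ n := Nat.cast_nonneg _
    have v1 : n * (ε / (1 + ε)) ≤ 2 * a * R * ε + 2 * C := by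
      have := mul_le_mul_of_nonneg_left l1 hn
      nlinarith
    have v2 : 2 * a * R * ε - 2 * C ≤ n * (ε / (1 - ε)) := by
      have := mul_le_mul_of_nonneg_left l2 hn
      nlinarith
    constructor
    · rw [le_div_iff₀ (by positivity)]
      have e1 : (a * (1 - ε) - C / (ε * R)) * (2 * R) = 2 * a * R * (1 - ε) - 2 * C / ε := by
        field_simp
      rw [e1]
      have e2 : 2 * a * R * (1 - ε) - 2 * C * (1 - ε) / ε ≤ n := by
        have h3 : 0 < 1 - ε := by linarith
        have := mul_le_mul_of_nonneg_right v2 (div_nonneg h3.le h0.le)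
        have e3 : n * (ε / (1 - ε)) * ((1 - ε) / ε) = n := by field_simp
        have e4 : (2 * a * R * ε - 2 * C) * ((1 - ε) / ε) =
          2 * a * R * (1 - ε) - 2 * C * (1 - ε) / ε := by field_simp
        linarith
      have e5 : 2 * C * (1 - ε) / ε ≤ 2 * C / ε :=
        div_le_div_of_nonneg_right (by nlinarith) h0.le
      linarith
    · rw [div_le_iff₀ (by positivity)]
      have e1 : (a * (1 + ε) + 2 * C / (ε * R)) * (2 * R) = 2 * a * R * (1 + ε) + 4 * C / ε := by
        field_simp
        ring
      rw [e1]
      have h3 : 0 < 1 + ε := by linarith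
      have e2 := mul_le_mul_of_nonneg_right v1 (div_nonneg h3.le h0.le)
      have e3 : n * (ε / (1 + ε)) * ((1 + ε) / ε) = n := by field_simp
      have e4 : (2 * a * R * ε + 2 * C) * ((1 + ε) / ε) =
          2 * a * R * (1 + ε) + 2 * C * (1 + ε) / ε := by field_simp
      have e5 : 2 * C * (1 + ε) / ε ≤ 4 * C / ε :=
        div_le_div_of_nonneg_right (by nlinarith) h0.le
      linarith
  unfold HasDensity
  rw [Metric.tendsto_atTop]
  intro η hη
  obtain ⟨ε, h0, h1, h2⟩ : ∃ ε : ℝ, 0 < ε ∧ ε < 1 ∧ a * ε < η / 2 := by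
    refine ⟨min (1 / 2) (η / (2 * (a + 1)) / 2), by positivity, by
      exact (min_le_left _ _).trans_lt (by norm_num), ?_⟩
    calc a * min (1 / 2) (η / (2 * (a + 1)) / 2) ≤ a * (η / (2 * (a + 1)) / 2) := by
          gcongr; exact min_le_right _ _
      _ = (η / 2) * (a / (a + 1) / 2) := by field_simp
      _ < (η / 2) * 1 := by
          gcongr
          have : a / (a + 1) ≤ 1 := by rw [div_le_one (by linarith)]; linarith
          linarith
      _ = η / 2 := by ring
  refine ⟨max 1 (max (R₀ / (1 - ε)) (4 * C / (ε * η) + 1)), fun R hR => ?_⟩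
  have g1 : 1 ≤ R := (le_max_left _ _).trans hR
  have g2 : R₀ / (1 - ε) ≤ R := (le_max_left _ _).trans ((le_max_right _ _).trans hR)
  have g3 : 4 * C / (ε * η) < R := by
    have := (le_max_right _ _).trans ((le_max_right _ _).trans hR)
    linarith
  have hR0 : 0 < R := by linarith
  rw [div_le_iff₀ (by linarith)] at g2
  have g4 : 2 * C / (ε * R) < η / 2 := by
    rw [div_lt_iff₀ (by positivity)] at g3 ⊢
    nlinarith
  have g5 : C / (ε * R) ≤ 2 * C / (ε * R) := by gcongr; linarith
  obtain ⟨m1, m2⟩ := main ε h0 h1 R hR0 g2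
  rw [Real.dist_eq, abs_lt]
  constructor <;> nlinarith

end Entire

/-! ### Characters and their common almost periods -/

theorem norm_chi (y x : ℝ) : ‖chi y x‖ = 1 := by
  have : chi y x = Complex.exp ((2 * Real.pi * y * x : ℝ) * Complex.I) := by
    unfold chi
    congr 1
    push_cast
    ring
  rw [this, Complex.norm_exp_ofReal_mul_I]

theorem chi_add (y s t : ℝ) : chi y (s + t) = chi y s * chi y t := by
  unfold chi
  rw [← Complex.exp_add]
  congr 1
  push_cast
  ring

theorem norm_chi_sub_sub_one (y s t : ℝ) : ‖chi y (s - t) - 1‖ = ‖chi y s - chi y t‖ := by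
  have h : chi y s - chi y t = (chi y (s - t) - 1) * chi y t := by
    rw [sub_mul, ← chi_add, one_mul, sub_add_cancel]
  rw [h, norm_mul, norm_chi, mul_one]

theorem norm_exp_two_pi_I_mul (y : ℝ) (z : ℂ) :
    ‖Complex.exp (2 * Real.pi * Complex.I * y * z)‖ = Real.exp (-(2 * Real.pi * y * z.im)) := by
  rw [Complex.norm_exp]
  congr 1
  have : 2 * (Real.pi : ℂ) * Complex.I * y * z = ((2 * Real.pi * y : ℝ) : ℂ) * (Complex.I * z) := by
    push_cast
    ring
  rw [this, Complex.re_ofReal_mul]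
  simp

/-- **Bohr's theorem** for finitely many characters: common almost periods are relatively dense. -/
theorem exists_almostPeriod {d : ℕ} (y : Fin d → ℝ) {ε : ℝ} (hε : 0 < ε) :
    ∃ L : ℝ, 0 < L ∧ ∀ t : ℝ, ∃ τ : ℝ, |τ - t| ≤ L ∧ ∀ j, ‖chi (y j) τ - 1‖ < ε := by
  set s : Set (Fin d → ℂ) := Set.range fun t : ℝ => fun j => chi (y j) t
  have hs : TotallyBounded s := by
    refine (isCompact_closedBall (0 : Fin d → ℂ) 1).totallyBounded.subset ?_
    rintro _ ⟨t, rfl⟩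
    rw [mem_closedBall_zero_iff, pi_norm_le_iff_of_nonneg zero_le_one]
    exact fun j => (norm_chi _ _).le
  obtain ⟨F, hFs, hF, hcover⟩ := Metric.finite_approx_of_totallyBounded hs ε hε
  choose! g hg using fun v (hv : v ∈ F) => hFs hv
  obtain ⟨L, hL⟩ := (hF.image fun v => |g v|).bddAbove
  refine ⟨max L 1, by positivity, fun t => ?_⟩
  have ht := hcover ⟨t, rfl⟩
  simp only [Set.mem_iUnion, Metric.mem_ball] at ht
  obtain ⟨v, hv, hd⟩ := ht
  -- The times `t` and `g v` have nearly equal character vectors, so their difference is an almost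
  -- period; only finitely many `g v` occur, whence the uniform `L`.
  refine ⟨t - g v, ?_, fun j => ?_⟩
  · have : |g v| ≤ L := hL ⟨v, hv, rfl⟩
    rw [sub_sub_cancel_left, abs_neg]
    exact this.trans (le_max_left _ _)
  · rw [norm_chi_sub_sub_one, ← dist_eq_norm]
    rw [← hg v hv] at hd
    exact (dist_le_pi_dist (fun j => chi (y j) t) (fun j => chi (y j) (g v)) j).trans_lt hd

/-! ### Growth of exponential sums off the real axis -/

section ExponentialSum

variable {d : ℕ} (c : Fin d → ℂ) (y : Fin d → ℝ)

theorem entireExt_add_ofReal_sub (z : ℂ) (τ : ℝ) :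
    entireExt c y (z + τ) - entireExt c y z =
      ∑ j, c j * Complex.exp (2 * Real.pi * Complex.I * y j * z) * (chi (y j) τ - 1) := by
  unfold entireExt chi
  rw [← Finset.sum_sub_distrib]
  refine Finset.sum_congr rfl fun j _ => ?_
  rw [mul_add, Complex.exp_add]
  ring

/-- Translations of an exponential sum by almost periods are uniformly close to it on strips. -/
theorem exists_almostPeriod_entireExt (H : ℝ) {ε : ℝ} (hε : 0 < ε) :
    ∃ L : ℝ, 0 < L ∧ ∀ t : ℝ, ∃ τ : ℝ, |τ - t| ≤ L ∧
      ∀ z : ℂ, |z.im| ≤ H → ‖entireExt c y (z + τ) - entireExt c y z‖ ≤ ε := by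
  set K : ℝ := ∑ j, ‖c j‖ * Real.exp (2 * Real.pi * |y j| * H) with hK
  have hK0 : 0 ≤ K := Finset.sum_nonneg fun j _ => by positivity
  obtain ⟨L, hL, h⟩ := exists_almostPeriod y (show 0 < ε / (K + 1) by positivity)
  refine ⟨L, hL, fun t => ?_⟩
  obtain ⟨τ, hτ, hj⟩ := h t
  refine ⟨τ, hτ, fun z hz => ?_⟩
  rw [entireExt_add_ofReal_sub]
  calc _ ≤ ∑ j, ‖c j‖ * Real.exp (2 * Real.pi * |y j| * H) * (ε / (K + 1)) := by
        refine norm_sum_le_of_le _ fun j _ => ?_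
        rw [norm_mul, norm_mul, norm_exp_two_pi_I_mul]
        gcongr
        · have h1 : -(y j * z.im) ≤ |y j| * H := by
            refine (neg_le_abs _).trans ?_
            rw [abs_mul]
            gcongr
          nlinarith [Real.pi_pos]
        · exact (hj j).le
    _ = K * (ε / (K + 1)) := by rw [← Finset.sum_mul]
    _ ≤ ε := by
        rw [mul_div_assoc', div_le_iff₀ (by positivity)]
        nlinarith

/-- The growth exponent of exponential sums with extreme frequencies `a ≤ b`. -/
noncomputable def growth (a b : ℝ) (z : ℂ) : ℝ := Real.pi * ((b - a) * |z.im| - (a + b) * z.im)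

theorem continuous_growth (a b : ℝ) : Continuous (growth a b) := by
  unfold growth
  fun_prop

/-- The left side is affine in `x`, hence maximal at an endpoint of `[a, b]`: at `a` in the upper
half-plane, at `b` in the lower. `growth` is this maximum. -/
theorem neg_two_pi_mul_le_growth {a b x : ℝ} (ha : a ≤ x) (hb : x ≤ b) (z : ℂ) :
    -(2 * Real.pi * x * z.im) ≤ growth a b z := by
  unfold growth
  rcases le_total 0 z.im with h | h
  · rw [abs_of_nonneg h]
    nlinarith [mul_nonneg (mul_nonneg Real.pi_pos.le h) (sub_nonneg.2 ha)]
  · rw [abs_of_nonpos h]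
    nlinarith [mul_nonneg (mul_nonneg Real.pi_pos.le (neg_nonneg.2 h)) (sub_nonneg.2 hb)]

theorem growth_of_nonneg (a b : ℝ) {z : ℂ} (h : 0 ≤ z.im) :
    growth a b z = -(2 * Real.pi * a * z.im) := by
  unfold growth
  rw [abs_of_nonneg h]
  ring

theorem growth_of_nonpos (a b : ℝ) {z : ℂ} (h : z.im ≤ 0) :
    growth a b z = -(2 * Real.pi * b * z.im) := by
  unfold growth
  rw [abs_of_nonpos h]
  ring

theorem circleAverage_growth (a b : ℝ) {R : ℝ} (hR : 0 ≤ R) :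
    Real.circleAverage (growth a b) 0 R = 2 * (b - a) * R := by
  have hi : ∀ u v : ℝ, IntervalIntegrable (fun θ => growth a b (circleMap 0 R θ))
      MeasureTheory.volume u v := fun u v =>
    ((continuous_growth a b).comp (continuous_circleMap 0 R)).intervalIntegrable u v
  have him : ∀ θ, (circleMap 0 R θ).im = R * Real.sin θ := fun θ => by
    simp [circleMap, Complex.exp_ofReal_mul_I_im]
  have h1 : ∫ θ in (0 : ℝ)..Real.pi, growth a b (circleMap 0 R θ) =
      -(2 * Real.pi * a * R) * 2 := by
    have hs : ∫ θ in (0 : ℝ)..Real.pi, Real.sin θ = 2 := by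
      rw [integral_sin]
      norm_num
    have : -(2 * Real.pi * a * R) * 2 = -(2 * Real.pi * a * R) *
        ∫ θ in (0 : ℝ)..Real.pi, Real.sin θ := by rw [hs]
    rw [this, ← intervalIntegral.integral_const_mul]
    refine intervalIntegral.integral_congr fun θ hθ => ?_
    rw [Set.uIcc_of_le Real.pi_pos.le] at hθ
    have : 0 ≤ (circleMap 0 R θ).im := by
      rw [him]
      exact mul_nonneg hR (Real.sin_nonneg_of_mem_Icc hθ)
    simp only [growth_of_nonneg a b this, him]
    ring
  have h2 : ∫ θ in Real.pi..(2 * Real.pi), growth a b (circleMap 0 R θ) =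
      (2 * Real.pi * b * R) * 2 := by
    have hs : ∫ θ in Real.pi..(2 * Real.pi), Real.sin θ = -2 := by
      rw [integral_sin]
      norm_num
    have : (2 * Real.pi * b * R) * 2 = -(2 * Real.pi * b * R) *
        ∫ θ in Real.pi..(2 * Real.pi), Real.sin θ := by rw [hs]; ring
    rw [this, ← intervalIntegral.integral_const_mul]
    refine intervalIntegral.integral_congr fun θ hθ => ?_
    rw [Set.uIcc_of_le (by linarith [Real.pi_pos])] at hθ
    have : (circleMap 0 R θ).im ≤ 0 := by
      rw [him]
      refine mul_nonpos_of_nonneg_of_nonpos hR ?_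
      have := Real.sin_nonneg_of_nonneg_of_le_pi (sub_nonneg.2 hθ.1) (by linarith [hθ.2])
      rw [Real.sin_sub_pi] at this
      linarith
    simp only [growth_of_nonpos a b this, him]
    ring
  rw [Real.circleAverage_def, ← intervalIntegral.integral_add_adjacent_intervals
    (hi 0 Real.pi) (hi _ _), h1, h2, smul_eq_mul]
  field_simp
  ring

variable {c y}

theorem norm_entireExt_le {a b : ℝ} (ha : ∀ j, a ≤ y j) (hb : ∀ j, y j ≤ b) (z : ℂ) :
    ‖entireExt c y z‖ ≤ (∑ j, ‖c j‖) * Real.exp (growth a b z) := by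
  unfold entireExt
  rw [Finset.sum_mul]
  refine norm_sum_le_of_le _ fun j _ => ?_
  rw [norm_mul, norm_exp_two_pi_I_mul]
  gcongr
  exact neg_two_pi_mul_le_growth (ha j) (hb j) z

/-- A lower bound for an exponential sum where one of its terms dominates. -/
theorem le_norm_entireExt_of_dominant (k : Fin d) {s : ℝ} (z : ℂ)
    (hs : s * ∑ j, ‖c j‖ ≤ ‖c k‖ / 2)
    (h : ∀ j, j ≠ k → Real.exp (-(2 * Real.pi * (y j - y k) * z.im)) ≤ s) (hs0 : 0 ≤ s) :
    ‖c k‖ / 2 * Real.exp (-(2 * Real.pi * y k * z.im)) ≤ ‖entireExt c y z‖ := by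
  set E := Real.exp (-(2 * Real.pi * y k * z.im))
  have hE : 0 < E := Real.exp_pos _
  have hsum : entireExt c y z = c k * Complex.exp (2 * Real.pi * Complex.I * y k * z) +
      ∑ j ∈ Finset.univ.erase k, c j * Complex.exp (2 * Real.pi * Complex.I * y j * z) :=
    (Finset.add_sum_erase _ _ (Finset.mem_univ k)).symm
  have hrest : ‖∑ j ∈ Finset.univ.erase k, c j * Complex.exp (2 * Real.pi * Complex.I * y j * z)‖
      ≤ (s * ∑ j, ‖c j‖) * E := by
    calc _ ≤ ∑ j ∈ Finset.univ.erase k, ‖c j‖ * (s * E) := by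
          refine norm_sum_le_of_le _ fun j hj => ?_
          rw [norm_mul, norm_exp_two_pi_I_mul]
          gcongr
          have := mul_le_mul_of_nonneg_right (h j (Finset.ne_of_mem_erase hj)) hE.le
          rw [← Real.exp_add] at this
          refine le_trans (le_of_eq ?_) this
          congr 1
          ring
      _ ≤ ∑ j, ‖c j‖ * (s * E) := by
          refine Finset.sum_le_sum_of_subset_of_nonneg (Finset.erase_subset _ _) ?_
          intros
          positivity
      _ = (s * ∑ j, ‖c j‖) * E := by rw [← Finset.sum_mul]; ring
  rw [hsum]
  have h1 := norm_sub_le_norm_add (c k * Complex.exp (2 * Real.pi * Complex.I * y k * z))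
    (∑ j ∈ Finset.univ.erase k, c j * Complex.exp (2 * Real.pi * Complex.I * y j * z))
  rw [norm_mul, norm_exp_two_pi_I_mul] at h1
  have h2 := mul_le_mul_of_nonneg_right hs hE.le
  change ‖c k‖ * E - _ ≤ _ at h1
  linarith

/-- Away from a horizontal strip an exponential sum is comparable to its extreme terms. -/
theorem exists_strip_le_norm_entireExt {lo hi : Fin d} (hlo : ∀ j, j ≠ lo → y lo < y j)
    (hhi : ∀ j, j ≠ hi → y j < y hi) (hclo : c lo ≠ 0) (hchi : c hi ≠ 0) :
    ∃ H δ : ℝ, 0 < H ∧ 0 < δ ∧ ∀ z : ℂ, H ≤ |z.im| →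
      δ * Real.exp (growth (y lo) (y hi) z) ≤ ‖entireExt c y z‖ := by
  have hS : 0 ≤ ∑ j, ‖c j‖ := Finset.sum_nonneg fun j _ => norm_nonneg _
  have hml : 0 < ‖c lo‖ := norm_pos_iff.2 hclo
  have hmh : 0 < ‖c hi‖ := norm_pos_iff.2 hchi
  set m := min ‖c lo‖ ‖c hi‖
  have hm : 0 < m := lt_min hml hmh
  -- With all other exponentials at most `s` times the dominant one, the remaining terms total at
  -- most half of the dominant term, whichever extreme it is.
  set s := m / 2 / (∑ j, ‖c j‖ + 1) with hs
  have hs0 : 0 < s := by positivity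
  have hsS : s * ∑ j, ‖c j‖ ≤ m / 2 := by
    rw [hs, div_mul_eq_mul_div, div_le_iff₀ (by positivity)]
    nlinarith
  have hlim : ∀ g : ℝ, 0 < g → ∀ᶠ t : ℝ in atTop, Real.exp (-(2 * Real.pi * g * t)) ≤ s := by
    intro g hg
    have : Tendsto (fun t : ℝ => Real.exp (-(2 * Real.pi * g * t))) atTop (𝓝 0) :=
      Real.tendsto_exp_neg_atTop_nhds_zero.comp
        (tendsto_id.const_mul_atTop (by positivity))
    exact (this.eventually (gt_mem_nhds hs0)).mono fun t h => h.le
  have hev : ∀ᶠ t : ℝ in atTop,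
      (∀ j, j ≠ lo → Real.exp (-(2 * Real.pi * (y j - y lo) * t)) ≤ s) ∧
      (∀ j, j ≠ hi → Real.exp (-(2 * Real.pi * (y hi - y j) * t)) ≤ s) := by
    refine Filter.Eventually.and (Filter.eventually_all.2 fun j => ?_)
      (Filter.eventually_all.2 fun j => ?_)
    · by_cases hj : j = lo
      · simp [hj]
      · exact (hlim _ (sub_pos.2 (hlo j hj))).mono fun t h _ => h
    · by_cases hj : j = hi
      · simp [hj]
      · exact (hlim _ (sub_pos.2 (hhi j hj))).mono fun t h _ => h
  obtain ⟨H, hH⟩ := eventually_atTop.1 hev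
  refine ⟨max H 1, m / 2, by positivity, by positivity, fun z hz => ?_⟩
  obtain ⟨k1, k2⟩ := hH |z.im| ((le_max_left _ _).trans hz)
  rcases le_total 0 z.im with h | h
  · rw [abs_of_nonneg h] at k1
    rw [growth_of_nonneg _ _ h]
    refine le_trans ?_ (le_norm_entireExt_of_dominant lo z
      (hsS.trans (by have := min_le_left ‖c lo‖ ‖c hi‖; linarith)) k1 hs0.le)
    gcongr
    exact min_le_left _ _
  · rw [abs_of_nonpos h] at k2
    rw [growth_of_nonpos _ _ h]
    refine le_trans ?_ (le_norm_entireExt_of_dominant hi z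
      (hsS.trans (by have := min_le_right ‖c lo‖ ‖c hi‖; linarith)) (fun j hj => ?_) hs0.le)
    · gcongr
      exact min_le_right _ _
    · refine le_trans (le_of_eq ?_) (k2 j hj)
      congr 1
      ring

theorem entireExt_ne_zero {lo hi : Fin d} (hlo : ∀ j, j ≠ lo → y lo < y j)
    (hhi : ∀ j, j ≠ hi → y j < y hi) (hclo : c lo ≠ 0) (hchi : c hi ≠ 0) :
    entireExt c y ≠ 0 := by
  obtain ⟨H, δ, hH, hδ, h⟩ := exists_strip_le_norm_entireExt hlo hhi hclo hchi
  intro h0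
  have := h (H * Complex.I) (by simpa using le_abs_self H)
  rw [h0, Pi.zero_apply, norm_zero] at this
  exact absurd this (not_le.2 (by positivity))

end ExponentialSum

/-! ### Good circles and the density of the complex zeros -/

section Density

variable {d : ℕ} {c : Fin d → ℂ} {y : Fin d → ℝ}

/-- A relatively dense set of circles on which an exponential sum is comparable to its
extreme terms. -/
theorem exists_radius_le_norm_entireExt {lo hi : Fin d} (hlo : ∀ j, j ≠ lo → y lo < y j)
    (hhi : ∀ j, j ≠ hi → y j < y hi) (hclo : c lo ≠ 0) (hchi : c hi ≠ 0) :
    ∃ δ L T : ℝ, 0 < δ ∧ 0 < L ∧ ∀ t, T ≤ t → ∃ R, |R - t| ≤ L ∧ ∀ z : ℂ, ‖z‖ = R →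
      δ * Real.exp (growth (y lo) (y hi) z) ≤ ‖entireExt c y z‖ := by
  have hf := differentiable_entireExt c y
  have hf0 := entireExt_ne_zero hlo hhi hclo hchi
  obtain ⟨H, δ, hH, hδ, hstrip⟩ := exists_strip_le_norm_entireExt hlo hhi hclo hchi
  -- Zeros are countable, so some `x₀` avoids all their real parts up to sign.
  obtain ⟨x₀, hx₀⟩ : ∃ x₀ : ℝ, ∀ z : ℂ, z.re = x₀ ∨ z.re = -x₀ → entireExt c y z ≠ 0 := by
    have hZ := zeroSet_countable hf hf0
    have hA := (hZ.image Complex.re).union (hZ.image fun z => -z.re)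
    obtain ⟨x₀, hx⟩ := (hA.dense_compl ℝ).nonempty
    refine ⟨x₀, fun z hz h0 => hx ?_⟩
    rcases hz with hz | hz
    · exact Or.inl ⟨z, h0, hz⟩
    · exact Or.inr ⟨z, h0, by simp [hz]⟩
  set K : Set ℂ := ({x₀, -x₀} : Set ℝ) ×ℂ Set.Icc (-H) H
  have hK : IsCompact K := (Set.toFinite _).isCompact.reProdIm isCompact_Icc
  obtain ⟨η, hη, hsub⟩ := hK.exists_cthickening_subset_open
    (isOpen_ne_fun hf.continuous continuous_const) fun z hz => hx₀ z hz.1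
  obtain ⟨m, hm, hmin⟩ := hK.cthickening.exists_forall_le' (a := 0) (f := fun z => ‖entireExt c y z‖)
    hf.continuous.norm.continuousOn fun z hz => norm_pos_iff.2 (hsub hz)
  have hmin' : ∀ z w : ℂ, |w.im| ≤ H → w.re = x₀ ∨ w.re = -x₀ → z.im = w.im →
      |z.re - w.re| ≤ η → m ≤ ‖entireExt c y z‖ := by
    intro z w hw hw' him hre
    refine hmin z (Metric.mem_cthickening_of_dist_le z w η K ⟨hw', abs_le.1 hw⟩ ?_)
    rwa [Complex.dist_of_im_eq him, Real.dist_eq]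
  obtain ⟨L, hL, hper⟩ := exists_almostPeriod_entireExt c y H (half_pos hm)
  set B := Real.pi * ((|y hi - y lo| + |y lo + y hi|) * H) with hB
  have hgrow : ∀ z : ℂ, |z.im| ≤ H → growth (y lo) (y hi) z ≤ B := by
    intro z hz
    rw [hB, add_mul]
    unfold growth
    gcongr
    rw [sub_eq_add_neg]
    gcongr
    · exact le_abs_self _
    · refine (neg_le_abs _).trans ?_
      rw [abs_mul]
      gcongr
  -- The radius will be `x₀ + τ`. The term `H ^ 2 / η` makes it so large that the circle, within the
  -- strip, stays `η`-close to vertical segments.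
  refine ⟨min δ (m / 2 * Real.exp (-B)), L + |x₀|, L + |x₀| + H ^ 2 / η + 1, by positivity,
    by positivity, fun t ht => ?_⟩
  obtain ⟨τ, hτ, htr⟩ := hper t
  have hRt : |x₀ + τ - t| ≤ L + |x₀| := by
    rw [add_sub_assoc, add_comm L]
    exact (abs_add_le _ _).trans (by gcongr)
  refine ⟨x₀ + τ, hRt, fun z hz => ?_⟩
  rcases le_total H |z.im| with hzH | hzH
  · refine le_trans ?_ (hstrip z hzH)
    gcongr
    exact min_le_left _ _
  have hlow : m / 2 ≤ ‖entireExt c y z‖ := by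
    set R := x₀ + τ with hR
    have hR1 : H ^ 2 / η < R := by linarith [(abs_le.1 hRt).1]
    have hR0 : 0 < R := lt_of_le_of_lt (by positivity) hR1
    have hsq : z.re ^ 2 + z.im ^ 2 = R ^ 2 := by
      rw [← hz, Complex.sq_norm, Complex.normSq_apply]
      ring
    have him : z.im ^ 2 ≤ H ^ 2 := by
      rw [← sq_abs z.im]
      gcongr
    rw [div_lt_iff₀ hη] at hR1
    have habs : |z.re| ≤ R := by
      rw [← hz]
      exact Complex.abs_re_le_norm z
    have hnear : R - |z.re| ≤ η := by
      have h1 : (R - |z.re|) * (R + |z.re|) = z.im ^ 2 := by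
        ring_nf
        rw [sq_abs]
        linarith
      have h2 : 0 ≤ (R - |z.re|) * |z.re| := mul_nonneg (by linarith) (abs_nonneg _)
      by_contra! h3
      nlinarith [mul_lt_mul_of_pos_right h3 hR0]
    -- The same `τ` serves both arcs: `z - τ` brings the right arc near `Re = x₀`, and `z + τ` the
    -- left arc near `Re = -x₀`. The value there is at least `m`, and translation changes it by at
    -- most `m / 2`.
    rcases le_total 0 z.re with h0 | h0
    · rw [abs_of_nonneg h0] at hnear habs
      have h1 := hmin' (z - τ) ⟨x₀, z.im⟩ hzH (Or.inl rfl) (by simp) (by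
        simp only [Complex.sub_re, Complex.ofReal_re]
        rw [abs_le]
        constructor <;> linarith)
      have h2 := htr (z - τ) (by simpa using hzH)
      rw [sub_add_cancel] at h2
      have h3 := norm_sub_norm_le (entireExt c y (z - τ)) (entireExt c y z)
      rw [norm_sub_rev] at h3
      linarith
    · rw [abs_of_nonpos h0] at hnear habs
      have h1 := hmin' (z + τ) ⟨-x₀, z.im⟩ hzH (Or.inr rfl) (by simp) (by
        simp only [Complex.add_re, Complex.ofReal_re]
        rw [abs_le]
        constructor <;> linarith)
      have h2 := htr z hzH
      have h3 := norm_sub_norm_le (entireExt c y (z + τ)) (entireExt c y z)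
      linarith
  calc _ ≤ m / 2 * Real.exp (-B) * Real.exp B := by
        gcongr
        · exact min_le_right _ _
        · exact hgrow z hzH
    _ = m / 2 := by rw [mul_assoc, ← Real.exp_add, neg_add_cancel, Real.exp_zero, mul_one]
    _ ≤ _ := hlow

theorem exists_abs_zeroLogCount_entireExt_sub_le {lo hi : Fin d}
    (hlo : ∀ j, j ≠ lo → y lo < y j) (hhi : ∀ j, j ≠ hi → y j < y hi)
    (hclo : c lo ≠ 0) (hchi : c hi ≠ 0) :
    ∃ C T : ℝ, ∀ t, T ≤ t →
      |zeroLogCount (entireExt c y) t - 2 * (y hi - y lo) * t| ≤ C := by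
  have hf := differentiable_entireExt c y
  have hf0 := entireExt_ne_zero hlo hhi hclo hchi
  have hle : ∀ j, y lo ≤ y j := fun j => by
    by_cases h : j = lo
    · rw [h]
    · exact (hlo j h).le
  have hge : ∀ j, y j ≤ y hi := fun j => by
    by_cases h : j = hi
    · rw [h]
    · exact (hhi j h).le
  obtain ⟨δ, L, T, hδ, hL, hgood⟩ := exists_radius_le_norm_entireExt hlo hhi hclo hchi
  set κ := Real.log ‖meromorphicTrailingCoeffAt (entireExt c y) 0‖
  set S := ∑ j, ‖c j‖
  set C := |Real.log δ| + |Real.log S| + |κ| with hC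
  set a := y hi - y lo
  have ha : 0 ≤ a := sub_nonneg.2 (hge lo)
  have hcircle : ∀ R : ℝ, 0 < R → (∀ z : ℂ, ‖z‖ = R →
      δ * Real.exp (growth (y lo) (y hi) z) ≤ ‖entireExt c y z‖) →
      |zeroLogCount (entireExt c y) R - 2 * a * R| ≤ C := by
    intro R hR hz
    have hJ := circleAverage_log_norm_eq_zeroLogCount hf hR
    have hI1 : CircleIntegrable (fun z => Real.log ‖entireExt c y z‖) 0 R :=
      MeromorphicOn.circleIntegrable_log_norm fun w _ => (hf.analyticAt w).meromorphicAt
    have hI2 : CircleIntegrable (growth (y lo) (y hi)) 0 R :=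
      (continuous_growth _ _).continuousOn.circleIntegrable hR.le
    have hbound : ∀ z ∈ Metric.sphere (0 : ℂ) |R|,
        growth (y lo) (y hi) z - Real.log ‖entireExt c y z‖ ≤ |Real.log δ| ∧
        Real.log ‖entireExt c y z‖ - growth (y lo) (y hi) z ≤ |Real.log S| := by
      intro z hzR
      rw [mem_sphere_zero_iff_norm, abs_of_pos hR] at hzR
      have h1 := hz z hzR
      have h2 := norm_entireExt_le (c := c) hle hge z
      have h3 : 0 < δ * Real.exp (growth (y lo) (y hi) z) := by positivity
      have hS : 0 < S := by
        by_contra! hS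
        nlinarith [Real.exp_pos (growth (y lo) (y hi) z)]
      have h4 := Real.log_le_log h3 h1
      have h5 := Real.log_le_log (h3.trans_le h1) h2
      rw [Real.log_mul hδ.ne' (Real.exp_ne_zero _), Real.log_exp] at h4
      rw [Real.log_mul hS.ne' (Real.exp_ne_zero _), Real.log_exp] at h5
      constructor
      · linarith [neg_le_abs (Real.log δ)]
      · linarith [le_abs_self (Real.log S)]
    have e1 := Real.circleAverage_mono_on_of_le_circle (hI2.sub hI1) fun z hz => (hbound z hz).1
    have e2 := Real.circleAverage_mono_on_of_le_circle (hI1.sub hI2) fun z hz => (hbound z hz).2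
    rw [Real.circleAverage_sub hI2 hI1, circleAverage_growth _ _ hR.le, hJ] at e1
    rw [Real.circleAverage_sub hI1 hI2, circleAverage_growth _ _ hR.le, hJ] at e2
    rw [abs_le]
    constructor <;>
      linarith [le_abs_self κ, neg_le_abs κ, abs_nonneg (Real.log δ), abs_nonneg (Real.log S)]
  -- Good radii near `t - L` and `t + L` enclose `t` and lie within `2 * L` of it, so the main term
  -- moves by at most `2 * a * (2 * L)`.
  refine ⟨C + 4 * a * L, |T| + 2 * L + 1, fun t ht => ?_⟩
  have hT := le_abs_self T
  have hT' := abs_nonneg T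
  obtain ⟨R₁, hR₁, hz₁⟩ := hgood (t - L) (by linarith)
  obtain ⟨R₂, hR₂, hz₂⟩ := hgood (t + L) (by linarith)
  rw [abs_le] at hR₁ hR₂
  have b1 := abs_le.1 (hcircle R₁ (by linarith) hz₁)
  have b2 := abs_le.1 (hcircle R₂ (by linarith) hz₂)
  have m1 := zeroLogCount_mono hf hf0 (show 0 < R₁ by linarith) (show R₁ ≤ t by linarith)
  have m2 := zeroLogCount_mono hf hf0 (show 0 < t by linarith) (show t ≤ R₂ by linarith)
  rw [abs_le]
  constructor <;> nlinarith

/-- The zeros of an exponential sum have density equal to the length of its spectrum. -/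
theorem hasDensity_complexCount {lo hi : Fin d}
    (hlo : ∀ j, j ≠ lo → y lo < y j) (hhi : ∀ j, j ≠ hi → y j < y hi)
    (hclo : c lo ≠ 0) (hchi : c hi ≠ 0) :
    HasDensity (complexCount c y) (y hi - y lo) := by
  obtain ⟨C, T, h⟩ := exists_abs_zeroLogCount_entireExt_sub_le hlo hhi hclo hchi
  refine hasDensity_zeroCount_of_zeroLogCount (differentiable_entireExt c y)
    (entireExt_ne_zero hlo hhi hclo hchi) ?_ h
  by_cases hh : hi = lo
  · simp [hh]
  · exact sub_nonneg.2 (hlo hi hh).le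

end Density

/-! ### Real zeros against nonreal zeros -/

section RealZeros

variable {d : ℕ} {c : Fin d → ℂ} {y : Fin d → ℝ}

/-- Real and complex multiplicities of a real zero agree. -/
theorem analyticOrderNatAt_trigPoly (h0 : entireExt c y ≠ 0) (x : ℝ) :
    analyticOrderNatAt (trigPoly c y) x = analyticOrderNatAt (entireExt c y) x := by
  have hf := differentiable_entireExt c y
  have restrict : ∀ g : ℂ → ℂ, AnalyticAt ℂ g x → AnalyticAt ℝ (fun t : ℝ => g t) x :=
    fun g hg => (hg.restrictScalars (𝕜 := ℝ)).comp (Complex.ofRealCLM.analyticAt x)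
  have hn := Nat.cast_analyticOrderNatAt (analyticOrderAt_ne_top_of_entire hf h0 (x : ℂ))
  -- The local factorisation `(z - x) ^ n • g z` with `g x ≠ 0` restricts to the real line with the
  -- same `n`.
  obtain ⟨g, hg, hgx, heq⟩ := ((hf.analyticAt (x : ℂ)).analyticOrderAt_eq_natCast).1 hn.symm
  have hreal : analyticOrderAt (trigPoly c y) x =
      (analyticOrderNatAt (entireExt c y) x : ℕ) := by
    have ht : AnalyticAt ℝ (trigPoly c y) x := restrict _ (hf.analyticAt _)
    rw [ht.analyticOrderAt_eq_natCast]
    refine ⟨fun t => g t, restrict g hg, hgx, ?_⟩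
    filter_upwards [Complex.continuous_ofReal.continuousAt.eventually heq] with t ht
    rw [← entireExt_ofReal, ht, Complex.real_smul, smul_eq_mul]
    push_cast
    rfl
  unfold analyticOrderNatAt at hreal ⊢
  rw [hreal, ENat.toNat_natCast]

theorem complexCount_eq_realCount_add_nonreal (h0 : entireExt c y ≠ 0) (R : ℝ) :
    complexCount c y R = realCount c y R +
      ∑ᶠ z ∈ {z | entireExt c y z = 0 ∧ z.im ≠ 0} ∩ Metric.ball 0 R,
        analyticOrderNatAt (entireExt c y) z := by
  have hfin := zerosInBall_finite (differentiable_entireExt c y) h0 R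
  have hreal : realCount c y R = ∑ᶠ z ∈ (((↑) : ℝ → ℂ) '' (realZeros c y ∩ Metric.ball 0 R)),
      analyticOrderNatAt (entireExt c y) z := by
    rw [finsum_mem_image Complex.ofReal_injective.injOn]
    exact finsum_mem_congr rfl fun x _ => analyticOrderNatAt_trigPoly h0 x
  have hunion : complexZeros c y ∩ Metric.ball 0 R =
      (((↑) : ℝ → ℂ) '' (realZeros c y ∩ Metric.ball 0 R)) ∪
      {z | entireExt c y z = 0 ∧ z.im ≠ 0} ∩ Metric.ball 0 R := by
    ext z
    constructor
    · rintro ⟨hz, hR⟩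
      by_cases him : z.im = 0
      · have hzr : ((z.re : ℝ) : ℂ) = z := Complex.ext rfl (by simp [him])
        refine Or.inl ⟨z.re, ⟨?_, ?_⟩, hzr⟩
        · change trigPoly c y z.re = 0
          rw [← entireExt_ofReal, hzr]
          exact hz
        · rw [mem_ball_zero_iff] at hR ⊢
          rwa [← hzr, Complex.norm_real] at hR
      · exact Or.inr ⟨⟨hz, him⟩, hR⟩
    · rintro (⟨x, ⟨hx, hR⟩, rfl⟩ | ⟨⟨hz, -⟩, hR⟩)
      · refine ⟨(entireExt_ofReal c y x).trans hx, ?_⟩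
        rw [mem_ball_zero_iff] at hR ⊢
        rwa [Complex.norm_real]
      · exact ⟨hz, hR⟩
  have hfin' := hfin
  change (complexZeros c y ∩ Metric.ball 0 R).Finite at hfin'
  rw [hunion] at hfin'
  unfold complexCount
  rw [hunion, hreal]
  refine finsum_mem_union ?_ (hfin'.subset Set.subset_union_left)
    (hfin'.subset Set.subset_union_right)
  rw [Set.disjoint_left]
  rintro _ ⟨x, -, rfl⟩ ⟨⟨-, him⟩, -⟩
  exact him (Complex.ofReal_im x)

theorem realCount_eq_complexCount (h0 : entireExt c y ≠ 0)
    (h : ((↑) : ℝ → ℂ) '' realZeros c y = complexZeros c y) :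
    realCount c y = complexCount c y := by
  funext R
  have hempty : {z | entireExt c y z = 0 ∧ z.im ≠ 0} = ∅ := by
    rw [Set.eq_empty_iff_forall_notMem]
    rintro z ⟨hz, him⟩
    obtain ⟨x, -, rfl⟩ := h.ge (show z ∈ complexZeros c y from hz)
    exact him (Complex.ofReal_im x)
  rw [complexCount_eq_realCount_add_nonreal h0, hempty, Set.empty_inter, finsum_mem_empty, add_zero]

theorem exists_nonreal_zero (h : ((↑) : ℝ → ℂ) '' realZeros c y ≠ complexZeros c y) :
    ∃ w, entireExt c y w = 0 ∧ w.im ≠ 0 := by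
  by_contra! hall
  refine h (Set.Subset.antisymm ?_ fun z hz => ?_)
  · rintro _ ⟨x, hx, rfl⟩
    exact (entireExt_ofReal c y x).trans hx
  · have hzr : ((z.re : ℝ) : ℂ) = z := Complex.ext rfl (by simp [hall z hz])
    refine ⟨z.re, ?_, hzr⟩
    change trigPoly c y z.re = 0
    rw [← entireExt_ofReal, hzr]
    exact hz

/-- The nonreal zeros of an exponential sum are relatively dense, if there are any. -/
theorem exists_nonreal_zero_near (h0 : entireExt c y ≠ 0) {w : ℂ} (hw : entireExt c y w = 0)
    (him : w.im ≠ 0) :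
    ∃ Q : ℝ, 0 < Q ∧ ∀ t : ℝ, ∃ z, entireExt c y z = 0 ∧ z.im ≠ 0 ∧ ‖z - t‖ ≤ Q := by
  have hf := differentiable_entireExt c y
  obtain ⟨r, hr, hrw, hsph⟩ : ∃ r : ℝ, 0 < r ∧ r < |w.im| ∧
      ∀ z ∈ Metric.sphere w r, entireExt c y z ≠ 0 := by
    have hne : ∀ᶠ z in 𝓝[≠] w, entireExt c y z ≠ 0 := by
      rcases (hf.analyticAt w).eventually_eq_zero_or_eventually_ne_zero with h | h
      · exact absurd (analyticOrderAt_eq_top.2 h) (analyticOrderAt_ne_top_of_entire hf h0 w)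
      · exact h
    rw [eventually_nhdsWithin_iff, Metric.eventually_nhds_iff] at hne
    obtain ⟨ε, hε, h⟩ := hne
    have hpos : 0 < |w.im| := abs_pos.2 him
    refine ⟨min ε |w.im| / 2, by positivity, ?_, fun z hz => ?_⟩
    · linarith [min_le_right ε |w.im|]
    · have hd : dist z w = min ε |w.im| / 2 := hz
      have hlt : 0 < min ε |w.im| := by positivity
      refine h (by rw [hd]; linarith [min_le_left ε |w.im|]) fun hzw => ?_
      rw [hzw, dist_self] at hd
      linarith
  obtain ⟨m, hm, hmin⟩ := (isCompact_sphere w r).exists_forall_le' (a := 0)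
    (f := fun z => ‖entireExt c y z‖) hf.continuous.norm.continuousOn
    fun z hz => norm_pos_iff.2 (hsph z hz)
  -- An error of `m / 8` leaves `‖g w‖ ≤ m / 8` and `‖g z - g w‖ ≥ 3m / 4` on the sphere, so the
  -- open mapping radius `3m / 8` around `g w` reaches `0`. As `r < |w.im|`, the zero found is
  -- nonreal.
  obtain ⟨L, hL, hper⟩ := exists_almostPeriod_entireExt c y (|w.im| + r)
    (show 0 < m / 8 by positivity)
  refine ⟨r + ‖w‖ + L, by positivity, fun t => ?_⟩
  obtain ⟨τ, hτ, htr⟩ := hper t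
  set g : ℂ → ℂ := fun z => entireExt c y (z + τ) with hg
  have hgd : Differentiable ℂ g := hf.comp (differentiable_id.add_const _)
  have hball : ∀ z ∈ Metric.closedBall w r, |z.im| ≤ |w.im| + r := by
    intro z hz
    have h1 : |(z - w).im| ≤ r := (Complex.abs_im_le_norm _).trans (by
      rwa [← dist_eq_norm])
    have h2 := abs_add_le w.im (z - w).im
    rw [Complex.sub_im, add_sub_cancel] at h2
    rw [Complex.sub_im] at h1
    linarith
  have hgw : ‖g w‖ ≤ m / 8 := by
    have := htr w (by linarith)
    rwa [hw, sub_zero] at this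
  have hgs : ∀ z ∈ Metric.sphere w r, m * (3 / 4) ≤ ‖g z - g w‖ := by
    intro z hz
    have h1 := htr z (hball z (Metric.sphere_subset_closedBall hz))
    have h2 := hmin z hz
    have h3 := norm_sub_norm_le (entireExt c y z) (entireExt c y z - g z)
    have h4 := norm_sub_norm_le (g z) (g w)
    rw [sub_sub_cancel, norm_sub_rev (entireExt c y z)] at h3
    change ‖g z - entireExt c y z‖ ≤ m / 8 at h1
    change m ≤ ‖entireExt c y z‖ at h2
    linarith
  have hfreq : ∃ᶠ z in 𝓝 w, g z ≠ g w := by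
    intro hev
    have hconst : ∀ z, g z = g w := fun z =>
      (hgd.differentiableOn.analyticOnNhd isOpen_univ).eqOn_of_preconnected_of_eventuallyEq
        (analyticOnNhd_const (v := g w)) isPreconnected_univ (Set.mem_univ w)
        (by simpa [Filter.EventuallyEq] using hev) (Set.mem_univ z)
    obtain ⟨z, hz⟩ := (NormedSpace.sphere_nonempty (x := w) (r := r)).2 hr.le
    have := hgs z hz
    rw [hconst z, sub_self, norm_zero] at this
    linarith
  obtain ⟨z, hz, hgz⟩ := hgd.diffContOnCl.ball_subset_image_closedBall hr hgs hfreq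
    (show (0 : ℂ) ∈ Metric.ball (g w) (m * (3 / 4) / 2) by
      rw [mem_ball_iff_norm, zero_sub, norm_neg]
      linarith)
  rw [mem_closedBall_iff_norm] at hz
  refine ⟨z + τ, hgz, ?_, ?_⟩
  · rw [Complex.add_im, Complex.ofReal_im, add_zero]
    intro hz0
    have := (Complex.abs_im_le_norm (z - w)).trans hz
    rw [Complex.sub_im, hz0, zero_sub, abs_neg] at this
    linarith
  · have h1 : z + τ - t = (z - w) + w + ((τ - t : ℝ) : ℂ) := by
      push_cast
      ring
    rw [h1]
    refine (norm_add₃_le).trans ?_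
    rw [Complex.norm_real, Real.norm_eq_abs]
    gcongr

/-- A nonreal zero forces a positive proportion of nonreal zeros. -/
theorem exists_realCount_add_le_complexCount (h0 : entireExt c y ≠ 0) {w : ℂ}
    (hw : entireExt c y w = 0) (him : w.im ≠ 0) :
    ∃ δ : ℝ, 0 < δ ∧ ∀ᶠ R : ℝ in atTop,
      (realCount c y R : ℝ) / (2 * R) + δ ≤ (complexCount c y R : ℝ) / (2 * R) := by
  have hf := differentiable_entireExt c y
  obtain ⟨Q, hQ, hnear⟩ := exists_nonreal_zero_near h0 hw him
  -- Since `M > 2 * Q`, the discs of radius `Q` about the points `n * M` are disjoint, so their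
  -- zeros are distinct.
  set M := 2 * Q + 1 with hM
  choose z hz0 hzim hz using fun n : ℕ => hnear (n * M)
  have hinj : Function.Injective z := by
    intro i j hij
    have h1 := hz i
    rw [hij, norm_sub_rev] at h1
    have h2 := (norm_add_le _ _).trans (add_le_add h1 (hz j))
    rw [sub_add_sub_cancel, ← Complex.ofReal_sub, Complex.norm_real, Real.norm_eq_abs,
      ← sub_mul, abs_mul, abs_of_pos (show 0 < M by positivity)] at h2
    have h3 : |(i : ℝ) - j| < 1 := by
      by_contra! h3
      nlinarith
    have h4 : |(i : ℤ) - j| < 1 := by exact_mod_cast h3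
    rw [Int.abs_lt_one_iff] at h4
    omega
  refine ⟨1 / (4 * M), by positivity, ?_⟩
  filter_upwards [eventually_ge_atTop (4 * M)] with R hR
  have hMpos : 0 < M := by positivity
  have hRpos : 0 < R := by linarith
  set k := ⌊(R - Q) / M⌋₊
  have hk1 : (k : ℝ) ≤ (R - Q) / M := Nat.floor_le (div_nonneg (by linarith) hMpos.le)
  have hk2 : (R - Q) / M < k + 1 := Nat.lt_floor_add_one _
  have hcount : realCount c y R + k ≤ complexCount c y R := by
    rw [complexCount_eq_realCount_add_nonreal h0]
    gcongr
    have hfin : ({z | entireExt c y z = 0 ∧ z.im ≠ 0} ∩ Metric.ball 0 R).Finite :=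
      (zerosInBall_finite hf h0 R).subset fun u hu => ⟨hu.1.1, hu.2⟩
    rw [finsum_mem_eq_finite_toFinset_sum _ hfin]
    calc k = ∑ u ∈ (Finset.range k).image z, 1 := by
          rw [Finset.sum_const, smul_eq_mul, mul_one, Finset.card_image_of_injective _ hinj,
            Finset.card_range]
      _ ≤ ∑ u ∈ (Finset.range k).image z, analyticOrderNatAt (entireExt c y) u := by
          refine Finset.sum_le_sum fun u hu => ?_
          obtain ⟨n, -, rfl⟩ := Finset.mem_image.1 hu
          exact analyticOrderNatAt_pos_of_zero hf h0 (hz0 n)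
      _ ≤ _ := by
          refine Finset.sum_le_sum_of_subset fun u hu => ?_
          obtain ⟨n, hn, rfl⟩ := Finset.mem_image.1 hu
          rw [Set.Finite.mem_toFinset]
          refine ⟨⟨hz0 n, hzim n⟩, ?_⟩
          rw [mem_ball_zero_iff]
          have h1 := norm_sub_norm_le (z n) (n * M : ℝ)
          rw [Complex.norm_real, Real.norm_eq_abs, abs_of_nonneg (by positivity)] at h1
          have h2 : (n : ℝ) + 1 ≤ k := by exact_mod_cast Finset.mem_range.1 hn
          rw [le_div_iff₀ hMpos] at hk1
          nlinarith [hz n]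
  have hcount' : (realCount c y R : ℝ) + k ≤ complexCount c y R := by exact_mod_cast hcount
  rw [← sub_nonneg]
  have e : (complexCount c y R : ℝ) / (2 * R) - (realCount c y R / (2 * R) + 1 / (4 * M)) =
      ((complexCount c y R : ℝ) - realCount c y R - R / (2 * M)) / (2 * R) := by
    field_simp
    ring
  rw [e]
  refine div_nonneg ?_ (by positivity)
  have h3 : R / (2 * M) ≤ (R - Q) / M - 1 := by
    rw [div_sub_one hMpos.ne', div_le_div_iff₀ (by positivity) hMpos]
    nlinarith
  linarith

end RealZeros

/-! ### Upper densities and the conclusion -/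

theorem upperDensity_eq {N : ℝ → ℕ} {ρ : ℝ} (h : HasDensity N ρ) : upperDensity N = ρ :=
  Tendsto.limsup_eq h

/-- If `N` stays below a counting function with density `ρ` by a definite proportion, then
its upper density is less than `ρ`. -/
theorem upperDensity_lt {N N' : ℝ → ℕ} {ρ δ : ℝ} (h : HasDensity N' ρ) (hδ : 0 < δ)
    (hle : ∀ᶠ R : ℝ in atTop, (N R : ℝ) / (2 * R) + δ ≤ (N' R : ℝ) / (2 * R)) :
    upperDensity N < ρ := by
  have h1 : ∀ᶠ R : ℝ in atTop, (N R : ℝ) / (2 * R) ≤ ρ - δ / 2 := by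
    filter_upwards [hle, h.eventually (gt_mem_nhds (show ρ < ρ + δ / 2 by linarith))] with R h2 h3
    linarith
  -- The real `limsup` is an infimum of eventual upper bounds; nonnegativity of the ratios bounds
  -- these below.
  have h2 : IsCoboundedUnder (· ≤ ·) atTop fun R : ℝ => (N R : ℝ) / (2 * R) := by
    refine IsCoboundedUnder.of_frequently_ge (a := 0) (Eventually.frequently ?_)
    filter_upwards [eventually_ge_atTop 0] with R hR
    positivity
  have h3 : upperDensity N ≤ ρ - δ / 2 := limsup_le_of_le h2 h1
  linarith

theorem theorem2 (d : ℕ) (hd : 2 ≤ d) (y : Fin d → ℝ) (hy : StrictMono y)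
    (c : Fin d → ℂ) (hc : ∀ j, c j ≠ 0) :
    (((↑) : ℝ → ℂ) '' realZeros c y = complexZeros c y ↔
      ∃ ρ : ℝ, HasDensity (realCount c y) ρ ∧ HasDensity (complexCount c y) ρ) ∧
    (((↑) : ℝ → ℂ) '' realZeros c y = complexZeros c y ↔
      HasDensity (complexCount c y) (upperDensity (realCount c y))) ∧
    HasDensity (complexCount c y) (y ⟨d - 1, by omega⟩ - y ⟨0, by omega⟩) := by
  have hlo : ∀ j : Fin d, j ≠ ⟨0, by omega⟩ → y ⟨0, by omega⟩ < y j := fun j hj =>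
    hy (lt_of_le_of_ne (Fin.mk_le_of_le_val (Nat.zero_le _)) hj.symm)
  have hhi : ∀ j : Fin d, j ≠ ⟨d - 1, by omega⟩ → y j < y ⟨d - 1, by omega⟩ := fun j hj =>
    hy (lt_of_le_of_ne (Fin.le_def.2 (by have := j.2; simp only; omega)) hj)
  have h0 : entireExt c y ≠ 0 := entireExt_ne_zero hlo hhi (hc _) (hc _)
  have hdens := hasDensity_complexCount (c := c) hlo hhi (hc _) (hc _)
  -- This settles both converses, since a density is in particular an upper density.
  have key : ∀ ρ, HasDensity (complexCount c y) ρ → upperDensity (realCount c y) = ρ →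
      ((↑) : ℝ → ℂ) '' realZeros c y = complexZeros c y := by
    intro ρ hρ hup
    by_contra hne
    obtain ⟨w, hw, him⟩ := exists_nonreal_zero hne
    obtain ⟨δ, hδ, hle⟩ := exists_realCount_add_le_complexCount h0 hw him
    exact (upperDensity_lt hρ hδ hle).ne hup
  refine ⟨⟨fun h => ⟨_, ?_, hdens⟩, fun ⟨ρ, hr, hcx⟩ => key ρ hcx (upperDensity_eq hr)⟩,
    ⟨fun h => ?_, fun h => key _ h rfl⟩, hdens⟩
  · rwa [realCount_eq_complexCount h0 h]
  · rwa [realCount_eq_complexCount h0 h, upperDensity_eq hdens]
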